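/- Let $\mathbb P,\mathbb Q$ be probability measures on a countably generated measurable space $\mathcal Z$ with $\mathbb Q\ll\mathbb P$, and assume $g_\star=\frac{d\mathbb Q}{d\mathbb P}\in L^2_{\mathbb P}$. Let $\mathcal H$ be a separable real reproducing kernel Hilbert space on $\mathcal Z$ with measurable kernel $k$ and $\kappa_\infty=\sup_z k(z,z)<\infty$, and let $p_\star:\mathcal Z\to\mathbb R$ be measurable with $\pi_\infty=\sup_z|p_\star(z)|<\infty$. Let $J_{\mathbb P}:\mathcal H\to L^2_{\mathbb P}$ be the canonical embedding, and for $\lambda>0$ and $h\in\mathcal H$ put $$h_\lambda=(J_{\mathbb P}^*J_{\mathbb P}+\lambda)^{-1}J_{\mathbb P}^*(g_\star-p_\star),\qquad \mathcal E(h)=\sup_{\|f\|_{L^2_{\mathbb P}}\le1}\Big|\int f\,d\mathbb Q-\int f\,(p_\star+h)\,d\mathbb P\Big|.$$ Let $n\ge1$, and let $z_1,\dots,z_n\sim\mathbb P$ and $z_{n+1},\dots,z_{2n}\sim\mathbb Q$ be $2n$ independent random points. Let $S_{\mathbb P}h=(h(z_i))_{i\le n}$ and $S_{\mathbb Q}h=(h(z_{n+i}))_{i\le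 n}$ be the sampling operators $\mathcal H\to\mathbb R^n$, let $\boldsymbol p_\star=(p_\star(z_i))_{i\le n}$, and let $\boldsymbol 1=(1,\dots,1)\in\mathbb R^n$. Let $\boldsymbol K=(k(z_i,z_j))_{i,j\le 2n}$. Let $\epsilon\ge0$. Let $\Pi$ be a pivot set returned by the pivoted incomplete Cholesky decomposition of $\boldsymbol K$ with tolerance $\epsilon$: start with $d=\operatorname{diag}\boldsymbol K$, $\Pi=\emptyset$ and $\boldsymbol L$ without columns; while $\|d\|_1>\epsilon$, select any $\pi\notin\Pi$ with $d_\pi\ne0$, compute $\ell=d_\pi^{-1/2}(\boldsymbol K_{\cdot,\pi}-\boldsymbol L\boldsymbol L_{\pi,\cdot}^\top)$, add $\pi$ to $\Pi$, append $\ell$ as a column to $\boldsymbol L$, and replace $d$ by $d-\ell\circ\ell$. Let $P_\Pi$ be the orthogonal projection of $\mathcal H$ onto $\operatorname{span}\{k(\cdot,z_\pi):\pi\in\Pi\}$ and $$\widetilde h_\lambda=(P_\Pi S_{\mathbb P}^*S_{\mathbb P}P_\Pi+n\lambda)^{-1}P_\Pi\,(S_{\mathbb Q}^*\boldsymbol 1-S_{\mathbb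 P}^*\boldsymbol p_\star).$$ Put $$C_{FS}(\eta,s)=2\sqrt{2\log(2/\eta)\,\kappa_\infty}\,\big(1+\pi_\infty+s\sqrt{\kappa_\infty}\big),\qquad C_{AE}(\epsilon,\lambda)=\epsilon^{1/2}\big(1+\lambda^{-1/2}\kappa_\infty^{1/2}\big)(\pi_\infty+1).$$ Then for every $\eta\in(0,1)$, with probability at least $1-\eta$, for every admissible choice of the pivots, $$\|h_\lambda-\widetilde h_\lambda\|_{\mathcal H}\le\big(C_{FS}(\eta,\|h_\lambda\|_{\mathcal H})+C_{AE}(\epsilon,\lambda)\big)\lambda^{-1}n^{-1/2},$$ $$\mathcal E(\widetilde h_\lambda)\le\mathcal E(h_\lambda)+\kappa_\infty^{1/2}\big(C_{FS}(\eta,\|h_\lambda\|_{\mathcal H})+C_{AE}(\epsilon,\lambda)\big)\lambda^{-1}n^{-1/2},$$ and moreover, if $g_\star-p_\star=J_{\mathbb P}h_0$ for some $h_0\in\mathcal H$, then $$\mathcal E(\widetilde h_\lambda)\le2^{-1/2}\|h_0\|_{\mathcal H}\,\lambda^{1/2}+\kappa_\infty^{1/2}\big(C_{FS}(\eta,\|h_0\|_{\mathcal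 H})+C_{AE}(\epsilon,\lambda)\big)\lambda^{-1}n^{-1/2}.$$ -/

import Mathlib

open MeasureTheory ProbabilityTheory

namespace KDM

noncomputable section

/-! ### Scalar kernel of a real reproducing kernel Hilbert space -/

section Kernel

variable {Z : Type*} (H : Type*) [NormedAddCommGroup H] [InnerProductSpace ℝ H] [CompleteSpace H]
  [RKHS ℝ H Z ℝ]

/-- The kernel section `k(·, z)`, as an element of `H`. -/
def kerSec (z : Z) : H := RKHS.kerFun H z (1 : ℝ)

/-- The reproducing kernel `k(x, y)` of `H`. -/
def ker (x y : Z) : ℝ := RKHS.kernel H x y (1 : ℝ)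

/-- `κ_∞ = sup_z k(z, z)`. -/
def kappa : ℝ := ⨆ z : Z, ker H z z

variable {H}

lemma kerSec_apply (y x : Z) : (kerSec H y) x = ker H x y := RKHS.kerFun_apply H y 1 x

lemma inner_kerSec (h : H) (z : Z) : inner ℝ (kerSec H z) h = h z := by
  simp [kerSec]

lemma norm_kerSec_sq (z : Z) : ‖kerSec H z‖ ^ 2 = ker H z z := by
  rw [← real_inner_self_eq_norm_sq, inner_kerSec, kerSec_apply]

lemma norm_apply_le_sqrt_kappa (hb : BddAbove (Set.range fun z : Z => ker H z z)) (h : H) (z : Z) :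
    ‖h z‖ ≤ Real.sqrt (kappa H) * ‖h‖ := by
  rw [← inner_kerSec]
  refine (norm_inner_le_norm _ _).trans (mul_le_mul_of_nonneg_right ?_ (norm_nonneg _))
  exact Real.le_sqrt_of_sq_le ((norm_kerSec_sq z).trans_le (le_ciSup hb z))

/-- All functions in `H` are measurable if the kernel is. -/
lemma measurable_coe [MeasurableSpace Z] (hk : Measurable fun x : Z × Z => ker H x.1 x.2) (h : H) :
    Measurable (h : Z → ℝ) := by
  have hsec : ∀ y : Z, Measurable (kerSec H y : Z → ℝ) := fun y => by
    have : (kerSec H y : Z → ℝ) = fun x => ker H x y := funext (kerSec_apply y)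
    rw [this]
    have hpair : Measurable fun x : Z => (x, y) := by fun_prop
    have hcomp := Measurable.comp (g := fun x : Z × Z => ker H x.1 x.2) hk hpair
    exact hcomp
  let V : Submodule ℝ H :=
    { carrier := {f | Measurable (f : Z → ℝ)}
      add_mem' := fun {f g} hf hg => by
        have h1 : Measurable fun x => f x + g x := Measurable.add hf hg
        have h2 : (⇑(f + g) : Z → ℝ) = fun x => f x + g x := RKHS.coe_add f g
        exact h2.symm.subst (motive := Measurable) h1
      zero_mem' := by
        have h2 : (⇑(0 : H) : Z → ℝ) = fun _ => 0 := RKHS.coe_zero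
        exact h2.symm.subst (motive := Measurable) measurable_const
      smul_mem' := fun c f hf => by
        have h1 : Measurable fun x => c * f x := Measurable.const_mul hf c
        have h2 : (⇑(c • f) : Z → ℝ) = fun x => c * f x := RKHS.coe_smul f c
        exact h2.symm.subst (motive := Measurable) h1 }
  have hV : {g : H | ∃ x v, RKHS.kerFun H x v = g} ⊆ V := by
    intro f hf
    obtain ⟨x, v, hxv⟩ := hf
    have h1 : v • kerSec H x = f := by
      rw [← hxv, kerSec, ← ContinuousLinearMap.map_smul, smul_eq_mul, mul_one]
    rw [← h1]
    exact V.smul_mem v (hsec x)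
  have hspan : ∀ f ∈ Submodule.span ℝ {g : H | ∃ x v, RKHS.kerFun H x v = g},
      Measurable (f : Z → ℝ) := fun f hf => Submodule.span_le.2 hV hf
  have hmem : h ∈ (Submodule.span ℝ {g : H | ∃ x v, RKHS.kerFun H x v = g}).topologicalClosure := by
    rw [RKHS.kerFun_dense H]; trivial
  obtain ⟨u, hu, hlim⟩ := mem_closure_iff_seq_limit.1 hmem
  refine measurable_of_tendsto_metrizable (fun m => hspan (u m) (hu m)) ?_
  rw [tendsto_pi_nhds]
  intro x
  exact ((RKHS.continuous_eval x).tendsto h).comp hlim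

/-- Bounded measurable functions are square integrable with respect to a finite measure. -/
lemma memLp_of_bdd [MeasurableSpace Z] (M : Measure Z) [IsFiniteMeasure M] {p : Z → ℝ}
    (hp : Measurable p) (hpb : BddAbove (Set.range fun z => |p z|)) : MemLp p 2 M :=
  MemLp.of_bound hp.aestronglyMeasurable (⨆ z, |p z|)
    (Filter.Eventually.of_forall fun z => le_ciSup hpb z)

lemma memLp_coe [MeasurableSpace Z] (hk : Measurable fun x : Z × Z => ker H x.1 x.2)
    (hb : BddAbove (Set.range fun z : Z => ker H z z)) (M : Measure Z) [IsFiniteMeasure M] (h : H) :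
    MemLp (h : Z → ℝ) 2 M :=
  MemLp.of_bound (measurable_coe hk h).aestronglyMeasurable (Real.sqrt (kappa H) * ‖h‖)
    (Filter.Eventually.of_forall fun z => norm_apply_le_sqrt_kappa hb h z)

/-- The canonical embedding `J_M : H → L²(M)`, sending `h` to its almost everywhere class. -/
def embL2 [MeasurableSpace Z] (hk : Measurable fun x : Z × Z => ker H x.1 x.2)
    (hb : BddAbove (Set.range fun z : Z => ker H z z)) (M : Measure Z) [IsProbabilityMeasure M] :
    H →L[ℝ] Lp ℝ 2 M :=
  LinearMap.mkContinuous
    { toFun := fun h => (memLp_coe hk hb M h).toLp (h : Z → ℝ)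
      map_add' := fun _ _ => by
        rw [← MemLp.toLp_add]
        exact MemLp.toLp_congr _ _ (Filter.EventuallyEq.of_eq (RKHS.coe_add _ _))
      map_smul' := fun _ _ => by
        rw [RingHom.id_apply, ← MemLp.toLp_const_smul]
        exact MemLp.toLp_congr _ _ (Filter.EventuallyEq.of_eq (RKHS.coe_smul _ _)) }
    (Real.sqrt (kappa H)) (fun h => by
      refine (Lp.norm_le_of_ae_bound (f := (memLp_coe hk hb M h).toLp (h : Z → ℝ))
        (C := Real.sqrt (kappa H) * ‖h‖) (by positivity) ?_).trans ?_
      · filter_upwards [(memLp_coe hk hb M h).coeFn_toLp] with z hz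
        rw [hz]
        exact norm_apply_le_sqrt_kappa hb h z
      · simp [measureUnivNNReal])

/-- The sampling operator `h ↦ (h(z_i))_i`; its adjoint is `v ↦ ∑ i, v_i k(·, z_i)`. -/
def sampleOp {n : ℕ} (z : Fin n → Z) : H →L[ℝ] EuclideanSpace ℝ (Fin n) :=
  (EuclideanSpace.equiv (Fin n) ℝ).symm.toContinuousLinearMap ∘L
    ContinuousLinearMap.pi fun i => innerSL ℝ (kerSec H (z i))

lemma sampleOp_apply {n : ℕ} (z : Fin n → Z) (h : H) (i : Fin n) : sampleOp z h i = h (z i) := by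
  simp [sampleOp, inner_kerSec]

end Kernel

/-! ### Regularized inverses -/

section Inverse

variable {H : Type*} [NormedAddCommGroup H] [InnerProductSpace ℝ H] [CompleteSpace H]

/-- `(A + c)⁻¹`, as a bounded operator. -/
def regInv (A : H →L[ℝ] H) (c : ℝ) : H →L[ℝ] H := Ring.inverse (A + c • 1)

/-- `(A + c)⁻¹` is a genuine inverse when `A` is positive and `c > 0`. -/
lemma isUnit_add_smul_one {A : H →L[ℝ] H} (hA : A.IsPositive) {c : ℝ} (hc : 0 < c) :
    IsUnit (A + c • (1 : H →L[ℝ] H)) := by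
  refine ContinuousLinearMap.isUnit_of_forall_le_norm_inner_map _ (c := ⟨c, hc.le⟩) hc fun x => ?_
  have h1 : 0 ≤ inner ℝ (A x) x := hA.inner_nonneg_left x
  have h2 : inner ℝ ((A + c • (1 : H →L[ℝ] H)) x) x = inner ℝ (A x) x + c * ‖x‖ ^ 2 := by
    simp [inner_add_left, inner_smul_left]
  rw [h2, Real.norm_eq_abs, mul_comm]
  exact (le_add_of_nonneg_left h1).trans (le_abs_self _)

end Inverse

/-! ### Population quantities -/

section Population

variable {Z : Type*} [MeasurableSpace Z]

/-- The density ratio `g⋆ = dQ/dP`. -/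
def densityRatio (P Q : Measure Z) (z : Z) : ℝ := (Q.rnDeriv P z).toReal

/-- `g⋆ - p⋆`, as an element of `L²(P)`. -/
def residual (P Q : Measure Z) [IsProbabilityMeasure P] (hg : MemLp (densityRatio P Q) 2 P)
    {p : Z → ℝ} (hp : Measurable p) (hpb : BddAbove (Set.range fun z => |p z|)) : Lp ℝ 2 P :=
  (hg.sub (memLp_of_bdd P hp hpb)).toLp (densityRatio P Q - p)

variable {H : Type*} [NormedAddCommGroup H] [InnerProductSpace ℝ H] [CompleteSpace H]
  [RKHS ℝ H Z ℝ]

/-- `h_λ = (J_P* J_P + λ)⁻¹ J_P* (g⋆ - p⋆)`. -/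
def popEstimator (hk : Measurable fun x : Z × Z => ker H x.1 x.2)
    (hb : BddAbove (Set.range fun z : Z => ker H z z))
    (P Q : Measure Z) [IsProbabilityMeasure P] (hg : MemLp (densityRatio P Q) 2 P)
    {p : Z → ℝ} (hp : Measurable p) (hpb : BddAbove (Set.range fun z => |p z|)) (lam : ℝ) : H :=
  regInv ((embL2 hk hb P).adjoint ∘L embL2 hk hb P) lam
    ((embL2 hk hb P).adjoint (residual P Q hg hp hpb))

/-- The worst-case expectation error
`E(h) = sup { |∫ f dQ - ∫ f (p⋆ + h) dP| : f ∈ L²(P), ‖f‖ ≤ 1 }`. -/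
def worstCaseError (P Q : Measure Z) (p : Z → ℝ) (h : H) : ℝ :=
  ⨆ f : Metric.closedBall (0 : Lp ℝ 2 P) 1,
    |(∫ z, (f : Lp ℝ 2 P) z ∂Q) - ∫ z, (f : Lp ℝ 2 P) z * (p z + h z) ∂P|

end Population

/-! ### Pivoted incomplete Cholesky decomposition -/

section Cholesky

variable {ι : Type*} [Fintype ι]

/-- The new column `(d_p)^{-1/2} (K_{·,p} - L (L_{p,·})ᵀ)`; `L` is the list of the columns found so
far. -/
def cholCol (K : Matrix ι ι ℝ) (L : List (ι → ℝ)) (d : ι → ℝ) (p : ι) : ι → ℝ :=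
  fun i => (Real.sqrt (d p))⁻¹ * (K i p - (L.map fun l => l i * l p).sum)

/-- `CholReach K ε Π L d`: the algorithm with kernel matrix `K` and tolerance `ε` can reach the
state with pivots `Π`, columns `L` (both listed with the newest first) and residual diagonal `d`.
Every choice of an admissible pivot is allowed at each step. -/
inductive CholReach (K : Matrix ι ι ℝ) (ε : ℝ) :
    List ι → List (ι → ℝ) → (ι → ℝ) → Prop
  | init : CholReach K ε [] [] (fun i => K i i)
  | step {piv : List ι} {L : List (ι → ℝ)} {d : ι → ℝ} (p : ι)
      (hreach : CholReach K ε piv L d) (hcont : ε < ∑ i, |d i|) (hnew : p ∉ piv) (hd : d p ≠ 0) :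
      CholReach K ε (p :: piv) (cholCol K L d p :: L)
        (fun i => d i - cholCol K L d p i * cholCol K L d p i)

/-- `piv` is a pivot set returned by the algorithm for some admissible sequence of pivot choices:
the stopping criterion `‖d‖₁ ≤ ε` holds. -/
def IsCholOutput (K : Matrix ι ι ℝ) (ε : ℝ) (piv : List ι) : Prop :=
  ∃ L d, CholReach K ε piv L d ∧ ∑ i, |d i| ≤ ε

end Cholesky

/-! ### Low-rank sample estimator -/

section Sample

variable {Z : Type*} (H : Type*) [NormedAddCommGroup H] [InnerProductSpace ℝ H] [CompleteSpace H]
  [RKHS ℝ H Z ℝ]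

/-- The kernel matrix `K_{ij} = k(z_i, z_j)` of a finite family of points. -/
def kernelMatrix {ι : Type*} (z : ι → Z) : Matrix ι ι ℝ := fun i j => ker H (z i) (z j)

/-- `H_Π = span {k(·, z_π) : π ∈ Π}`. -/
def pivotSpace {ι : Type*} (z : ι → Z) (piv : List ι) : Submodule ℝ H :=
  Submodule.span ℝ ((fun i => kerSec H (z i)) '' {i | i ∈ piv})

instance instFiniteDimensionalPivotSpace {ι : Type*} (z : ι → Z) (piv : List ι) :
    FiniteDimensional ℝ (pivotSpace H z piv) :=
  FiniteDimensional.span_of_finite ℝ ((List.finite_toSet piv).image _)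

/-- The orthogonal projection `P_Π` of `H` onto `H_Π`. -/
def pivotProj {ι : Type*} (z : ι → Z) (piv : List ι) : H →L[ℝ] H :=
  (pivotSpace H z piv).starProjection

/-- The low-rank estimator
`(P_Π S_P* S_P P_Π + nλ)⁻¹ P_Π (S_Q* 1 - S_P* p⋆)` with `p⋆` evaluated at the `P`-sample. -/
def lowRankEstimator {n : ℕ} (zP zQ : Fin n → Z) (p : Z → ℝ) (lam : ℝ)
    (piv : List (Fin n ⊕ Fin n)) : H :=
  regInv
    (pivotProj H (Sum.elim zP zQ) piv ∘L (sampleOp zP).adjoint ∘L sampleOp zP ∘L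
      pivotProj H (Sum.elim zP zQ) piv)
    (n * lam)
    (pivotProj H (Sum.elim zP zQ) piv
      ((sampleOp zQ).adjoint (WithLp.toLp 2 fun _ => (1 : ℝ)) -
        (sampleOp zP).adjoint (WithLp.toLp 2 fun i => p (zP i))))

end Sample

/-- `C_FS(η, s) = 2 √(2 log(2/η) κ_∞) (1 + π_∞ + s √κ_∞)`. -/
def CFS (κ π η s : ℝ) : ℝ :=
  2 * Real.sqrt (2 * Real.log (2 / η) * κ) * (1 + π + s * Real.sqrt κ)

/-- `C_AE(ε, λ) = ε^{1/2} (1 + λ^{-1/2} κ_∞^{1/2}) (π_∞ + 1)`. -/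
def CAE (κ π ε lam : ℝ) : ℝ :=
  Real.sqrt ε * (1 + (Real.sqrt lam)⁻¹ * Real.sqrt κ) * (π + 1)

end

end KDM

namespace KDM

/-! ### Regularized linear equations -/

section Regularized

variable {E F : Type*} [NormedAddCommGroup E] [InnerProductSpace ℝ E] [CompleteSpace E]
  [NormedAddCommGroup F] [InnerProductSpace ℝ F] [CompleteSpace F]

/-! Write `S` for the sampling operator at the `P`-points, `b = S_Q* 1 - S* p⋆`, and let `x` solve
the full-rank equation `(S* S + nλ) x = b`. The error splits as `(h_λ - x) + (x - h̃_λ)`, and only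
the first summand needs probability.

Sampling error: `(S* S + nλ)(x - h_λ) = b - S* S h_λ - nλ h_λ`. The normal equation `λ h_λ = J*(g⋆ -
p⋆ - J h_λ)` makes `nλ h_λ` the expectation of `b - S* S h_λ`, so the right side is a centered sum
of `2n` independent bounded vectors of `H`. Since `h_λ` is deterministic, a vector Hoeffding
inequality (`one_sub_le_measureReal_norm_sum_le`) suffices and no operator concentration is needed;
inverting costs `1/(nλ)`.

Low-rank error: by `CholReach.gram` the Cholesky residual diagonal is `‖(1 - P_Π) k(·, z_i)‖²`, so
stopping bounds the sum of these squares by `ε`. Hence `‖S(1 - P_Π)‖ ≤ √ε` and `(1 - P_Π) b` is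
small, and `norm_projected_sub_le` turns this into the `C_AE` term. This holds for every sample and
every pivot sequence, so one event serves all pivot choices.

Finally `E(h) = ‖g⋆ - p⋆ - J h‖` in `L²(P)` (`worstCaseError_eq_norm`) is Lipschitz in `h` with
constant `√κ_∞`, and the source condition controls `E(h_λ)` and `‖h_λ‖` (`popEstimator_source`). -/

lemma regInv_spec {A : E →L[ℝ] E} (hA : A.IsPositive) {c : ℝ} (hc : 0 < c) (y : E) :
    A (regInv A c y) + c • regInv A c y = y := by
  have h := Ring.mul_inverse_cancel _ (isUnit_add_smul_one hA hc)
  simpa [regInv] using congrArg (fun T : E →L[ℝ] E => T y) h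

/-- Pairing the normal equation with its solution; the three norm bounds below are this identity
combined with Cauchy–Schwarz. -/
lemma energy_identity (S : E →L[ℝ] F) {c : ℝ} {x y : E} (h : S.adjoint (S x) + c • x = y) :
    ‖S x‖ ^ 2 + c * ‖x‖ ^ 2 = inner ℝ y x := by
  rw [← h, inner_add_left, ContinuousLinearMap.adjoint_inner_left, real_inner_smul_left,
    real_inner_self_eq_norm_sq, real_inner_self_eq_norm_sq]

lemma norm_le_of_regularized (S : E →L[ℝ] F) {c : ℝ} (hc : 0 < c) {x y : E}
    (h : S.adjoint (S x) + c • x = y) : ‖x‖ ≤ ‖y‖ / c := by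
  have h1 := energy_identity S h
  have h2 := real_inner_le_norm y x
  rw [le_div_iff₀ hc]
  by_contra! h3
  have hx : 0 < ‖x‖ := by
    by_contra! h4
    have : ‖x‖ = 0 := le_antisymm h4 (norm_nonneg _)
    rw [this] at h3
    linarith [norm_nonneg y]
  nlinarith [sq_nonneg ‖S x‖, mul_lt_mul_of_pos_right h3 hx]

/-- Maximizing `‖y‖ t - c t²` over `t = ‖x‖` gives `‖y‖² / (4c)`. The factor `1/2` is kept because
two such halves are added in `norm_projected_sub_le`. -/
lemma norm_map_le_of_regularized (S : E →L[ℝ] F) {c : ℝ} (hc : 0 < c) {x y : E}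
    (h : S.adjoint (S x) + c • x = y) : ‖S x‖ ≤ ‖y‖ / (2 * Real.sqrt c) := by
  have h1 := energy_identity S h
  have h2 := real_inner_le_norm y x
  have hs := Real.sqrt_pos.2 hc
  have hsq := Real.sq_sqrt hc.le
  rw [le_div_iff₀ (by positivity)]
  refine (sq_le_sq₀ (by positivity) (norm_nonneg _)).1 ?_
  have h3 : ‖S x‖ ^ 2 ≤ ‖y‖ * ‖x‖ - c * ‖x‖ ^ 2 := by linarith
  rw [mul_pow, mul_pow, hsq]
  nlinarith [sq_nonneg (‖y‖ - 2 * c * ‖x‖), mul_le_mul_of_nonneg_right h3 hc.le]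

/-- When the data lies in the range of the adjoint, `c ‖x‖² ≤ ‖u‖ t - t² ≤ ‖u‖² / 4` with `t = ‖S
x‖`; this loses only `c^{-1/2}` instead of `c⁻¹`. -/
lemma norm_le_of_regularized_adjoint (S : E →L[ℝ] F) {c : ℝ} (hc : 0 < c) {x : E} {u : F}
    (h : S.adjoint (S x) + c • x = S.adjoint u) : ‖x‖ ≤ ‖u‖ / (2 * Real.sqrt c) := by
  have h1 := energy_identity S h
  rw [ContinuousLinearMap.adjoint_inner_left] at h1
  have h2 := real_inner_le_norm u (S x)
  have hs := Real.sqrt_pos.2 hc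
  have hsq := Real.sq_sqrt hc.le
  rw [le_div_iff₀ (by positivity)]
  refine (sq_le_sq₀ (by positivity) (norm_nonneg _)).1 ?_
  rw [mul_pow, mul_pow, hsq]
  nlinarith [sq_nonneg (‖u‖ - 2 * ‖S x‖)]

/-- Restricting the regularized normal equation to a subspace `K` perturbs its solution by an
amount controlled by the residual of the data on `Kᗮ`. -/
lemma norm_projected_sub_le (S : E →L[ℝ] F) (K : Submodule ℝ E) [K.HasOrthogonalProjection]
    {c δ B B₁ : ℝ} (hc : 0 < c) (hδ : 0 ≤ δ) {x y b : E}
    (hx : S.adjoint (S x) + c • x = b)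
    (hy : K.starProjection (S.adjoint (S (K.starProjection y))) + c • y = K.starProjection b)
    (hS : ∀ v, ‖S (v - K.starProjection v)‖ ≤ δ * ‖v‖) (hb : ‖b‖ ≤ B)
    (hb₁ : ‖b - K.starProjection b‖ ≤ B₁) :
    ‖x - y‖ ≤ (B₁ + δ * B / Real.sqrt c) / c := by
  set R := K.starProjection with hR
  have hs := Real.sqrt_pos.2 hc
  have hRR : ∀ v, R (R v) = R v := fun v =>
    Submodule.starProjection_eq_self_iff.2 (Submodule.starProjection_apply_mem K v)
  have hRsymm : ∀ u v, inner ℝ (R u) v = inner ℝ u (R v) :=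
    fun u v => Submodule.inner_starProjection_left_eq_right K u v
  -- Applying the projection to the equation for `y` fixes every term except `c • y`, so `y` already
  -- lies in `K`.
  have hRy : R y = y := by
    have h1 := congrArg R hy
    rw [map_add, hRR, hRR, map_smul] at h1
    have h2 : c • R y = c • y := by
      rw [← hy] at h1
      exact add_left_cancel h1
    exact smul_right_injective E hc.ne' h2
  have hadj : ∀ u, (S ∘L R).adjoint u = R (S.adjoint u) := fun u => by
    refine ext_inner_right ℝ fun v => ?_
    rw [ContinuousLinearMap.adjoint_inner_left, hRsymm, ContinuousLinearMap.adjoint_inner_left]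
    rfl
  -- The dual form of `hS`: `(1 - R) S*` is the adjoint of `S (1 - R)`.
  have hQadj : ∀ u, ‖S.adjoint u - R (S.adjoint u)‖ ≤ δ * ‖u‖ := fun u => by
    set w := S.adjoint u - R (S.adjoint u) with hw
    have h0 : R w = 0 := by rw [hw, map_sub, hRR, sub_self]
    have h1 : ‖w‖ ^ 2 = inner ℝ u (S (w - R w)) := by
      rw [h0, sub_zero, ← ContinuousLinearMap.adjoint_inner_left, ← real_inner_self_eq_norm_sq]
      nth_rewrite 1 [hw]
      rw [inner_sub_left, hRsymm, h0, inner_zero_right, sub_zero]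
    have h2 : ‖w‖ ^ 2 ≤ ‖u‖ * (δ * ‖w‖) :=
      h1 ▸ (real_inner_le_norm _ _).trans (mul_le_mul_of_nonneg_left (hS w) (norm_nonneg _))
    by_contra! h3
    nlinarith [norm_nonneg u, norm_nonneg w, mul_nonneg hδ (norm_nonneg u)]
  have hxn : ‖x‖ ≤ B / c := (norm_le_of_regularized S hc hx).trans (by gcongr)
  have hSx : ‖S x‖ ≤ B / (2 * Real.sqrt c) :=
    (norm_map_le_of_regularized S hc hx).trans (by gcongr)
  -- Inside `K`, `R x - y` solves the regularized equation of `S ∘L R`, with data caused only by the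
  -- part of `x` outside `K` and in the range of the adjoint.
  have h1 : (S ∘L R).adjoint ((S ∘L R) (R x - y)) + c • (R x - y)
      = (S ∘L R).adjoint (-S (x - R x)) := by
    rw [hadj, hadj, ContinuousLinearMap.comp_apply, map_sub R, hRR, hRy, smul_sub]
    have h2 : c • y = R b - R (S.adjoint (S y)) := by
      rw [← hy, hRy]; abel
    have h3 : c • R x = R b - R (S.adjoint (S x)) := by
      rw [← hx, map_add, map_smul]; abel
    rw [h2, h3]
    simp only [map_sub, map_neg]
    abel
  have h2 : ‖R x - y‖ ≤ δ * (B / c) / (2 * Real.sqrt c) := by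
    refine (norm_le_of_regularized_adjoint _ hc h1).trans ?_
    rw [norm_neg]
    gcongr
    exact (hS x).trans (by gcongr)
  -- The component of `x` outside `K` is read off by applying `1 - R` to the full equation.
  have h3 : ‖x - R x‖ ≤ (B₁ + δ * (B / (2 * Real.sqrt c))) / c := by
    have h4 : c • (x - R x) = (b - R b) - (S.adjoint (S x) - R (S.adjoint (S x))) := by
      rw [← hx, map_add, map_smul, smul_sub]; abel
    rw [le_div_iff₀ hc]
    calc ‖x - R x‖ * c = ‖c • (x - R x)‖ := by
          rw [norm_smul, Real.norm_of_nonneg hc.le, mul_comm]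
      _ ≤ ‖b - R b‖ + ‖S.adjoint (S x) - R (S.adjoint (S x))‖ := h4 ▸ norm_sub_le _ _
      _ ≤ _ := add_le_add hb₁ ((hQadj _).trans (by gcongr))
  calc ‖x - y‖ = ‖(x - R x) + (R x - y)‖ := by congr 1; abel
    _ ≤ _ := norm_add_le _ _
    _ ≤ _ := add_le_add h3 h2
    _ = _ := by field_simp; ring

end Regularized

/-! ### Residual diagonal of the pivoted Cholesky decomposition -/

section CholeskyResidual

/-- Rank one update of the residual of an orthogonal projection. -/
lemma sub_starProjection_sup_span {E : Type*} [NormedAddCommGroup E] [InnerProductSpace ℝ E]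
    (K K' : Submodule ℝ E) [K.HasOrthogonalProjection] [K'.HasOrthogonalProjection] (v x : E)
    (hK : K' = K ⊔ Submodule.span ℝ {v}) :
    x - K'.starProjection x = (x - K.starProjection x) -
      (inner ℝ (x - K.starProjection x) (v - K.starProjection v) /
        ‖v - K.starProjection v‖ ^ 2) • (v - K.starProjection v) := by
  set r := v - K.starProjection v with hr
  set w := x - K.starProjection x with hw
  set a := inner ℝ w r / ‖r‖ ^ 2 with ha
  have hKle : K ≤ K' := hK ▸ le_sup_left
  have hv : v ∈ K' := hK ▸ Submodule.mem_sup_right (Submodule.mem_span_singleton_self v)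
  have hrK : r ∈ K' := K'.sub_mem hv (hKle (Submodule.starProjection_apply_mem K v))
  have hor : ∀ u ∈ K, inner ℝ (w - a • r) u = 0 := fun u hu => by
    rw [inner_sub_left, real_inner_smul_left, Submodule.starProjection_inner_eq_zero x u hu,
      Submodule.starProjection_inner_eq_zero v u hu]
    simp
  have hov : inner ℝ (w - a • r) v = 0 := by
    have h1 : v = K.starProjection v + r := by rw [hr]; abel
    rw [h1, inner_add_right, hor _ (Submodule.starProjection_apply_mem K v), zero_add,
      inner_sub_left, real_inner_smul_left, real_inner_self_eq_norm_sq, ha]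
    -- If `v` is already in `K`, then `r = 0` and the update is trivial.
    by_cases h0 : r = 0
    · simp [h0]
    · have : ‖r‖ ≠ 0 := norm_ne_zero_iff.2 h0
      field_simp
      simp
  have key : K'.starProjection x = x - (w - a • r) := by
    apply Submodule.eq_starProjection_of_mem_of_inner_eq_zero
    · have : x - (w - a • r) = K.starProjection x + a • r := by rw [hw]; abel
      rw [this]
      exact K'.add_mem (hKle (Submodule.starProjection_apply_mem K x)) (K'.smul_mem _ hrK)
    · intro u hu
      rw [sub_sub_cancel]
      rw [hK] at hu
      obtain ⟨u₁, hu₁, u₂, hu₂, rfl⟩ := Submodule.mem_sup.1 hu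
      obtain ⟨t, rfl⟩ := Submodule.mem_span_singleton.1 hu₂
      rw [inner_add_right, hor u₁ hu₁, inner_smul_right, hov, mul_zero, add_zero]
  rw [key, sub_sub_cancel]

variable {Z : Type*} (H : Type*) [NormedAddCommGroup H] [InnerProductSpace ℝ H] [CompleteSpace H]
  [RKHS ℝ H Z ℝ]

/-- The residual `(1 - P_Π) k(·, z_i)` of a kernel section. -/
noncomputable def pivotResidual {ι : Type*} (z : ι → Z) (piv : List ι) (i : ι) : H :=
  kerSec H (z i) - (pivotSpace H z piv).starProjection (kerSec H (z i))

lemma pivotSpace_cons {ι : Type*} (z : ι → Z) (piv : List ι) (q : ι) :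
    pivotSpace H z (q :: piv) = pivotSpace H z piv ⊔ Submodule.span ℝ {kerSec H (z q)} := by
  rw [pivotSpace, pivotSpace, ← Submodule.span_union]
  congr 1
  ext h
  simp only [Set.mem_image, Set.mem_ofPred_eq, List.mem_cons, Set.mem_union, Set.mem_singleton_iff]
  constructor
  · rintro ⟨i, rfl | hi, rfl⟩
    · exact Or.inr rfl
    · exact Or.inl ⟨i, hi, rfl⟩
  · rintro (⟨i, hi, rfl⟩ | rfl)
    · exact ⟨i, Or.inr hi, rfl⟩
    · exact ⟨q, Or.inl rfl, rfl⟩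

/-- Adding a pivot removes from each residual its component along the pivot's residual; on Gram
matrices this is the rank-one downdate performed by a Cholesky step. -/
lemma inner_pivotResidual_cons {ι : Type*} (z : ι → Z) (piv : List ι) (q i j : ι)
    (hq : ‖pivotResidual H z piv q‖ ≠ 0) :
    inner ℝ (pivotResidual H z (q :: piv) i) (pivotResidual H z (q :: piv) j) =
      inner ℝ (pivotResidual H z piv i) (pivotResidual H z piv j) -
        (‖pivotResidual H z piv q‖⁻¹ *
            inner ℝ (pivotResidual H z piv i) (pivotResidual H z piv q)) *
          (‖pivotResidual H z piv q‖⁻¹ *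
            inner ℝ (pivotResidual H z piv j) (pivotResidual H z piv q)) := by
  have h : ∀ i, pivotResidual H z (q :: piv) i = pivotResidual H z piv i -
      (inner ℝ (pivotResidual H z piv i) (pivotResidual H z piv q) /
        ‖pivotResidual H z piv q‖ ^ 2) • pivotResidual H z piv q := fun i =>
    sub_starProjection_sup_span _ _ _ _ (pivotSpace_cons H z piv q)
  rw [h i, h j]
  simp only [inner_sub_left, inner_sub_right, real_inner_smul_left, real_inner_smul_right,
    real_inner_self_eq_norm_sq]
  rw [real_inner_comm (pivotResidual H z piv j) (pivotResidual H z piv q)]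
  field_simp
  ring

/-- The algorithm computes the Gram matrix of the residuals of the kernel sections. -/
lemma CholReach.gram {ι : Type*} [Fintype ι] {z : ι → Z} {ε : ℝ} {piv : List ι}
    {L : List (ι → ℝ)} {d : ι → ℝ} (h : CholReach (kernelMatrix H z) ε piv L d) :
    (∀ i j, kernelMatrix H z i j - (L.map fun l => l i * l j).sum =
      inner ℝ (pivotResidual H z piv i) (pivotResidual H z piv j)) ∧
    ∀ i, d i = ‖pivotResidual H z piv i‖ ^ 2 := by
  induction h with
  | init =>
    have h0 : ∀ i, pivotResidual H z [] i = kerSec H (z i) := fun i => by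
      have hmem := Submodule.starProjection_apply_mem (pivotSpace H z []) (kerSec H (z i))
      have hbot : pivotSpace H z [] = ⊥ := by simp [pivotSpace]
      have h1 : (pivotSpace H z []).starProjection (kerSec H (z i)) = 0 :=
        (Submodule.mem_bot ℝ).1 (hbot.le hmem)
      rw [pivotResidual, h1, sub_zero]
    refine ⟨fun i j => ?_, fun i => ?_⟩
    · rw [h0, h0, inner_kerSec, kerSec_apply]
      simp [kernelMatrix]
    · rw [h0, norm_kerSec_sq]; rfl
  | @step piv L d q hreach hcont hnew hd ih =>
    obtain ⟨ih1, ih2⟩ := ih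
    have hsq : Real.sqrt (d q) = ‖pivotResidual H z piv q‖ := by
      rw [ih2, Real.sqrt_sq (norm_nonneg _)]
    -- The admissibility condition `d_π ≠ 0` says exactly that the new section is independent of the
    -- old pivot space.
    have hne : ‖pivotResidual H z piv q‖ ≠ 0 := fun h0 => hd (by rw [ih2, h0]; simp)
    have hcol : ∀ i, cholCol (kernelMatrix H z) L d q i = ‖pivotResidual H z piv q‖⁻¹ *
        inner ℝ (pivotResidual H z piv i) (pivotResidual H z piv q) := fun i => by
      rw [cholCol, ih1, hsq]
    refine ⟨fun i j => ?_, fun i => ?_⟩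
    · rw [List.map_cons, List.sum_cons, inner_pivotResidual_cons H z piv q i j hne, ← ih1 i j,
        hcol, hcol]
      ring
    · beta_reduce
      rw [← real_inner_self_eq_norm_sq, inner_pivotResidual_cons H z piv q i i hne, hcol, ih2,
        real_inner_self_eq_norm_sq]

lemma sum_norm_pivotResidual_sq_le {ι : Type*} [Fintype ι] {z : ι → Z} {ε : ℝ} {piv : List ι}
    (h : IsCholOutput (kernelMatrix H z) ε piv) : ∑ i, ‖pivotResidual H z piv i‖ ^ 2 ≤ ε := by
  obtain ⟨L, d, hr, hd⟩ := h
  refine le_trans (Finset.sum_le_sum fun i _ => ?_) hd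
  rw [← (CholReach.gram H hr).2 i]
  exact le_abs_self _

end CholeskyResidual

/-! ### A Hoeffding inequality in Hilbert spaces -/

section Concentration

/-- `cosh √s = ∑ sⁿ / (2n)!` is a power series in `s` with nonnegative coefficients, so convexity
holds term by term. -/
lemma cosh_sqrt_convex_combination_le {a b u v : ℝ} (ha : 0 ≤ a) (hb : 0 ≤ b) (hu : 0 ≤ u)
    (hv : 0 ≤ v) (huv : u + v = 1) :
    Real.cosh (Real.sqrt (u * a + v * b)) ≤
      u * Real.cosh (Real.sqrt a) + v * Real.cosh (Real.sqrt b) := by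
  have hs : ∀ s : ℝ, 0 ≤ s → HasSum (fun n : ℕ => s ^ n / ((2 * n).factorial : ℝ))
      (Real.cosh (Real.sqrt s)) := fun s h0 => by
    have h := Real.hasSum_cosh (Real.sqrt s)
    simpa only [pow_mul, Real.sq_sqrt h0] using h
  refine hasSum_le (fun n => ?_) (hs _ (by positivity))
    (((hs a ha).mul_left u).add ((hs b hb).mul_left v))
  have h := (convexOn_pow (𝕜 := ℝ) n).2 (Set.mem_Ici.2 ha) (Set.mem_Ici.2 hb) hu hv huv
  simp only [smul_eq_mul] at h
  calc (u * a + v * b) ^ n / ((2 * n).factorial : ℝ)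
      ≤ (u * a ^ n + v * b ^ n) / ((2 * n).factorial : ℝ) := by gcongr
    _ = _ := by ring

lemma integrable_of_measurable_of_bounded {Ω : Type*} [MeasurableSpace Ω] {μ : Measure Ω}
    [IsFiniteMeasure μ] {G : Type*} [NormedAddCommGroup G]
    [MeasurableSpace G] [BorelSpace G] [SecondCountableTopology G] {X : Ω → G}
    (hX : Measurable X) {C : ℝ}
    (hC : ∀ ω, ‖X ω‖ ≤ C) : Integrable X μ :=
  Integrable.of_bound hX.aestronglyMeasurable C (Filter.Eventually.of_forall hC)

lemma integrable_cosh_norm {Ω : Type*} [MeasurableSpace Ω] {μ : Measure Ω} [IsFiniteMeasure μ]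
    {G : Type*} [NormedAddCommGroup G] [MeasurableSpace G] [OpensMeasurableSpace G]
    {X : Ω → G} (hX : Measurable X) {C : ℝ} (hC : ∀ ω, ‖X ω‖ ≤ C) :
    Integrable (fun ω => Real.cosh ‖X ω‖) μ := by
  refine integrable_of_measurable_of_bounded (Real.continuous_cosh.measurable.comp hX.norm)
    (C := Real.cosh C) fun ω => ?_
  rw [Real.norm_of_nonneg (Real.cosh_pos _).le, Real.cosh_le_cosh, abs_of_nonneg (norm_nonneg _)]
  exact (hC ω).trans (le_abs_self C)

variable {E : Type*} [NormedAddCommGroup E] [InnerProductSpace ℝ E]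

/-- In an inner product space, `y ↦ cosh ‖x + y‖` is dominated on a ball by an affine function. -/
lemma cosh_norm_add_le (x y : E) {c : ℝ} (hy : ‖y‖ ≤ c) :
    Real.cosh ‖x + y‖ ≤ Real.cosh ‖x‖ * Real.cosh c +
      inner ℝ ((Real.sinh ‖x‖ * Real.sinh c / (‖x‖ * c)) • x) y := by
  have hc : 0 ≤ c := (norm_nonneg y).trans hy
  set m := ‖x‖ * c with hm
  have hm0 : 0 ≤ m := by positivity
  have hi : |inner ℝ x y| ≤ m :=
    (abs_real_inner_le_norm x y).trans (mul_le_mul_of_nonneg_left hy (norm_nonneg x))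
  -- The cosine-like parameter for which `‖x‖² + 2⟨x, y⟩ + c²` is the mean of `(‖x‖ ± c)²` with
  -- weights `(1 ± ρ)/2`. When `m = 0` the inner product vanishes too, so the value `0` of the
  -- division is harmless.
  set ρ := inner ℝ x y / m with hρ
  have hρm : ρ * m = inner ℝ x y := by
    by_cases h0 : m = 0
    · rw [h0] at hi ⊢
      rw [mul_zero, abs_nonpos_iff.1 hi]
    · rw [hρ, div_mul_cancel₀ _ h0]
  have hρ1 : |ρ| ≤ 1 := by
    rw [hρ, abs_div, abs_of_nonneg hm0]
    exact div_le_one_of_le₀ hi hm0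
  obtain ⟨hl, hr⟩ := abs_le.1 hρ1
  have h1 : ‖x + y‖ ≤ Real.sqrt ((1 - ρ) / 2 * (‖x‖ - c) ^ 2 + (1 + ρ) / 2 * (‖x‖ + c) ^ 2) := by
    refine Real.le_sqrt_of_sq_le ?_
    rw [norm_add_sq_real, ← hρm, hm]
    nlinarith [mul_self_le_mul_self (norm_nonneg y) hy]
  have h2 := cosh_sqrt_convex_combination_le (sq_nonneg (‖x‖ - c)) (sq_nonneg (‖x‖ + c))
    (by linarith : 0 ≤ (1 - ρ) / 2) (by linarith : 0 ≤ (1 + ρ) / 2) (by ring)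
  rw [Real.sqrt_sq_eq_abs, Real.sqrt_sq_eq_abs, Real.cosh_abs, Real.cosh_abs, Real.cosh_sub,
    Real.cosh_add] at h2
  have h3 : inner ℝ ((Real.sinh ‖x‖ * Real.sinh c / m) • x) y
      = ρ * (Real.sinh ‖x‖ * Real.sinh c) := by
    rw [real_inner_smul_left, hρ]; ring
  rw [h3]
  refine (Real.cosh_le_cosh.2 ?_).trans (h2.trans_eq (by ring))
  rw [abs_of_nonneg (norm_nonneg _), abs_of_nonneg (Real.sqrt_nonneg _)]
  exact h1

variable [CompleteSpace E] [MeasurableSpace E] [BorelSpace E] [SecondCountableTopology E]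
  {Ω : Type*} [MeasurableSpace Ω] {μ : Measure Ω} [IsProbabilityMeasure μ]

/-- In `cosh_norm_add_le` the term linear in `Y` has mean `⟨E φ(X), E Y⟩ = 0` by independence and
centering. -/
lemma integral_cosh_norm_add_le {X Y : Ω → E} (hX : Measurable X) (hY : Measurable Y)
    (hXY : IndepFun X Y μ) {C c : ℝ} (hC : ∀ ω, ‖X ω‖ ≤ C) (hc : ∀ ω, ‖Y ω‖ ≤ c)
    (hY0 : ∫ ω, Y ω ∂μ = 0) :
    ∫ ω, Real.cosh ‖X ω + Y ω‖ ∂μ ≤ Real.cosh c * ∫ ω, Real.cosh ‖X ω‖ ∂μ := by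
  set φ : E → E := fun x => (Real.sinh ‖x‖ * Real.sinh c / (‖x‖ * c)) • x with hφ
  have hφm : Measurable φ := by
    have h1 : Measurable fun x : E => Real.sinh ‖x‖ :=
      Real.continuous_sinh.measurable.comp measurable_norm
    exact ((h1.mul_const _).div (measurable_norm.mul_const _)).smul measurable_id
  have hφb : ∀ ω, ‖φ (X ω)‖ ≤ Real.sinh C * |Real.sinh c / c| := fun ω => by
    have h0 : 0 ≤ Real.sinh ‖X ω‖ := Real.sinh_nonneg_iff.2 (norm_nonneg _)
    have h1 : Real.sinh ‖X ω‖ ≤ Real.sinh C := Real.sinh_le_sinh.2 (hC ω)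
    by_cases hx : X ω = 0
    · simp only [hφ, hx, smul_zero, norm_zero]
      exact mul_nonneg (h0.trans h1) (abs_nonneg _)
    · have hx' : ‖X ω‖ ≠ 0 := norm_ne_zero_iff.2 hx
      have h2 : ‖φ (X ω)‖ = Real.sinh ‖X ω‖ * |Real.sinh c / c| := by
        simp only [hφ, norm_smul, Real.norm_eq_abs, abs_div, abs_mul, abs_of_nonneg h0, abs_norm]
        field_simp
      rw [h2]
      exact mul_le_mul_of_nonneg_right h1 (abs_nonneg _)
  have hφi : Integrable (fun ω => φ (X ω)) μ :=
    integrable_of_measurable_of_bounded (hφm.comp hX) hφb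
  have hYi : Integrable Y μ := integrable_of_measurable_of_bounded hY hc
  have hind : IndepFun (fun ω => φ (X ω)) Y μ := hXY.comp hφm measurable_id
  have hinner : ∫ ω, inner ℝ (φ (X ω)) (Y ω) ∂μ = 0 := by
    have h := IndepFun.integral_bilin hind hφi hYi (innerSL ℝ (E := E))
    rw [hY0, map_zero] at h
    exact h
  have hinneri : Integrable (fun ω => inner ℝ (φ (X ω)) (Y ω)) μ := by
    refine integrable_of_measurable_of_bounded ((hφm.comp hX).inner hY)
      (C := Real.sinh C * |Real.sinh c / c| * c) fun ω => (norm_inner_le_norm _ _).trans ?_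
    exact mul_le_mul (hφb ω) (hc ω) (norm_nonneg _) ((norm_nonneg _).trans (hφb ω))
  have hXi : Integrable (fun ω => Real.cosh ‖X ω‖) μ := integrable_cosh_norm hX hC
  calc ∫ ω, Real.cosh ‖X ω + Y ω‖ ∂μ
      ≤ ∫ ω, (Real.cosh ‖X ω‖ * Real.cosh c + inner ℝ (φ (X ω)) (Y ω)) ∂μ :=
        integral_mono (integrable_cosh_norm (X := fun ω => X ω + Y ω) (hX.add hY) (C := C + c)
          fun ω => (norm_add_le _ _).trans (add_le_add (hC ω) (hc ω)))
          ((hXi.mul_const _).add hinneri) fun ω => cosh_norm_add_le (X ω) (Y ω) (hc ω)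
    _ = _ := by
        rw [integral_add (hXi.mul_const _) hinneri, hinner, add_zero, integral_mul_const, mul_comm]

lemma integral_cosh_norm_sum_le {ι : Type*} {X : ι → Ω → E} (hX : ∀ i, Measurable (X i))
    (hind : iIndepFun X μ) {c : ι → ℝ} (hc : ∀ i ω, ‖X i ω‖ ≤ c i)
    (h0 : ∀ i, ∫ ω, X i ω ∂μ = 0) (s : Finset ι) :
    ∫ ω, Real.cosh ‖∑ i ∈ s, X i ω‖ ∂μ ≤ ∏ i ∈ s, Real.cosh (c i) := by
  classical
  induction s using Finset.induction_on with
  | empty => simp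
  | insert j s hj ih =>
    have hsum : Measurable fun ω => ∑ i ∈ s, X i ω := Finset.measurable_sum s fun i _ => hX i
    have hi : IndepFun (fun ω => ∑ i ∈ s, X i ω) (X j) μ := by
      have h := hind.indepFun_finsetSum_of_notMem hX hj
      have h2 : (∑ i ∈ s, X i) = fun ω => ∑ i ∈ s, X i ω := by ext ω; simp
      rwa [h2] at h
    rw [Finset.prod_insert hj]
    refine le_trans (le_of_eq ?_) ((integral_cosh_norm_add_le hsum (hX j) hi
      (C := ∑ i ∈ s, c i) (fun ω => norm_sum_le_of_le s fun i _ => hc i ω) (hc j) (h0 j)).trans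
      (mul_le_mul_of_nonneg_left ih (Real.cosh_pos _).le))
    refine integral_congr_ae (Filter.Eventually.of_forall fun ω => ?_)
    simp only [Finset.sum_insert hj]
    rw [add_comm]

lemma integral_cosh_norm_sum_le_exp {ι : Type*} [Fintype ι] {X : ι → Ω → E}
    (hX : ∀ i, Measurable (X i)) (hind : iIndepFun X μ) {c : ι → ℝ} (hc : ∀ i ω, ‖X i ω‖ ≤ c i)
    (h0 : ∀ i, ∫ ω, X i ω ∂μ = 0) {t : ℝ} (ht : 0 ≤ t) :
    ∫ ω, Real.cosh (t * ‖∑ i, X i ω‖) ∂μ ≤ Real.exp (t ^ 2 * (∑ i, c i ^ 2) / 2) := by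
  have h := integral_cosh_norm_sum_le (μ := μ) (X := fun i ω => t • X i ω) (c := fun i => t * c i)
    (fun i => (hX i).const_smul t)
    (hind.comp (fun _ x => t • x) fun _ => measurable_const_smul t)
    (fun i ω => by
      rw [norm_smul, Real.norm_of_nonneg ht]
      exact mul_le_mul_of_nonneg_left (hc i ω) ht)
    (fun i => by rw [integral_smul, h0, smul_zero]) Finset.univ
  simp only [← Finset.smul_sum, norm_smul, Real.norm_of_nonneg ht] at h
  refine h.trans ?_
  calc ∏ i, Real.cosh (t * c i) ≤ ∏ i, Real.exp ((t * c i) ^ 2 / 2) :=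
        Finset.prod_le_prod (fun i _ => (Real.cosh_pos _).le)
          fun i _ => Real.cosh_le_exp_half_sq _
    _ = _ := by
        rw [← Real.exp_sum]
        congr 1
        rw [Finset.mul_sum, Finset.sum_div]
        exact Finset.sum_congr rfl fun i _ => by ring

/-- Hoeffding's inequality for sums of independent bounded centered vectors of a Hilbert space. -/
theorem one_sub_le_measureReal_norm_sum_le {ι : Type*} [Fintype ι] {X : ι → Ω → E}
    (hX : ∀ i, Measurable (X i)) (hind : iIndepFun X μ) {c : ι → ℝ} (hc : ∀ i ω, ‖X i ω‖ ≤ c i)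
    (h0 : ∀ i, ∫ ω, X i ω ∂μ = 0) {η : ℝ} (hη : 0 < η) (hη1 : η < 1) :
    1 - η ≤ μ.real {ω | ‖∑ i, X i ω‖ ≤ Real.sqrt (2 * Real.log (2 / η) * ∑ i, c i ^ 2)} := by
  set v := ∑ i, c i ^ 2 with hv
  set l := Real.log (2 / η) with hl
  have hl0 : 0 < l := Real.log_pos (by rw [lt_div_iff₀ hη]; linarith)
  have hv0 : 0 ≤ v := Finset.sum_nonneg fun i _ => sq_nonneg _
  set r := Real.sqrt (2 * l * v) with hr
  have hmeas : Measurable fun ω => ∑ i, X i ω := Finset.measurable_sum _ fun i _ => hX i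
  have hset : MeasurableSet {ω | ‖∑ i, X i ω‖ ≤ r} := measurableSet_le hmeas.norm measurable_const
  -- For `v = 0` all summands vanish, and the choice `t = r / v` below would be meaningless.
  rcases hv0.eq_or_lt with hv0 | hv0
  · have hall : {ω | ‖∑ i, X i ω‖ ≤ r} = Set.univ := by
      refine Set.eq_univ_of_forall fun ω => ?_
      have hX0 : ∀ i, X i ω = 0 := fun i => by
        have hci : c i ^ 2 = 0 :=
          (Finset.sum_eq_zero_iff_of_nonneg fun i _ => sq_nonneg (c i)).1 hv0.symm i
            (Finset.mem_univ i)
        have := hc i ω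
        rw [pow_eq_zero_iff two_ne_zero |>.1 hci] at this
        exact norm_le_zero_iff.1 this
      change ‖∑ i, X i ω‖ ≤ r
      simp [hX0, hr, Real.sqrt_nonneg]
    rw [hall, probReal_univ]
    linarith
  · have hr2 : r ^ 2 = 2 * l * v := Real.sq_sqrt (by positivity)
    have hr0 : 0 < r := Real.sqrt_pos.2 (by positivity)
    -- Minimizer of `t² v / 2 - t r`; then `t r = 2l` and `t² v / 2 = l`. As `cosh u ≥ eᵘ / 2`,
    -- Markov's inequality gives the tail bound `2 e^{-l} = η`.
    set t := r / v with ht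
    have ht0 : 0 < t := by positivity
    have hint : Integrable (fun ω => Real.cosh (t * ‖∑ i, X i ω‖)) μ := by
      have h := integrable_cosh_norm (μ := μ) (X := fun ω => t • ∑ i, X i ω) (hmeas.const_smul t)
        (C := t * ∑ i, c i) fun ω => by
          rw [norm_smul, Real.norm_of_nonneg ht0.le]
          exact mul_le_mul_of_nonneg_left (norm_sum_le_of_le _ fun i _ => hc i ω) ht0.le
      simpa only [norm_smul, Real.norm_of_nonneg ht0.le] using h
    have hmk := mul_meas_ge_le_integral_of_nonneg (μ := μ)
      (Filter.Eventually.of_forall fun ω => (Real.cosh_pos (t * ‖∑ i, X i ω‖)).le) hint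
      (Real.exp (t * r) / 2)
    have hexp := hmk.trans (integral_cosh_norm_sum_le_exp hX hind hc h0 ht0.le)
    have htr : t * r = 2 * l := by rw [ht, div_mul_eq_mul_div, ← sq, hr2]; field_simp
    have htv : t ^ 2 * v / 2 = l := by rw [ht, div_pow, hr2]; field_simp
    rw [← hv, htr, htv, two_mul, Real.exp_add] at hexp
    have hel : Real.exp l = 2 / η := Real.exp_log (by positivity)
    rw [hel] at hexp
    have hle : μ.real {ω | ‖∑ i, X i ω‖ ≤ r}ᶜ ≤ η := by
      refine (measureReal_mono (fun ω hω => ?_)).trans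
        (le_of_mul_le_mul_left (hexp.trans_eq ?_) (by positivity : 0 < 2 / η * (2 / η) / 2))
      · have hω : r < ‖∑ i, X i ω‖ := not_le.1 hω
        change 2 / η * (2 / η) / 2 ≤ _
        rw [← hel, ← Real.exp_add, ← two_mul, ← htr, Real.cosh_eq]
        have h1 : Real.exp (t * r) ≤ Real.exp (t * ‖∑ i, X i ω‖) := Real.exp_le_exp.2 (by gcongr)
        linarith [Real.exp_pos (-(t * ‖∑ i, X i ω‖))]
      · field_simp
    rw [probReal_compl_eq_one_sub hset] at hle
    linarith

end Concentration

/-! ### Kernel sections and sampling operators -/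

section KernelSections

variable {Z : Type*} {H : Type*} [NormedAddCommGroup H] [InnerProductSpace ℝ H] [CompleteSpace H]
  [RKHS ℝ H Z ℝ]

lemma norm_kerSec_le (hb : BddAbove (Set.range fun z : Z => ker H z z)) (z : Z) :
    ‖kerSec H z‖ ≤ Real.sqrt (kappa H) :=
  Real.le_sqrt_of_sq_le ((norm_kerSec_sq z).trans_le (le_ciSup hb z))

lemma norm_weighted_kerSec_le (hb : BddAbove (Set.range fun z : Z => ker H z z))
    {p : Z → ℝ} (hpb : BddAbove (Set.range fun z => |p z|)) (h : H) (z : Z) :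
    ‖(p z + h z) • kerSec H z‖ ≤
      ((⨆ z, |p z|) + ‖h‖ * Real.sqrt (kappa H)) * Real.sqrt (kappa H) := by
  have h1 : |p z| ≤ ⨆ z, |p z| := le_ciSup hpb z
  have h2 : |h z| ≤ ‖h‖ * Real.sqrt (kappa H) :=
    (norm_apply_le_sqrt_kappa hb h z).trans_eq (mul_comm _ _)
  rw [norm_smul, Real.norm_eq_abs]
  exact mul_le_mul ((abs_add_le _ _).trans (add_le_add h1 h2)) (norm_kerSec_le hb z)
    (norm_nonneg _) ((abs_nonneg _).trans ((abs_add_le _ _).trans (add_le_add h1 h2)))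

lemma kappa_nonneg : 0 ≤ kappa (Z := Z) H :=
  Real.iSup_nonneg fun z => norm_kerSec_sq (H := H) z ▸ sq_nonneg _

/-- `H` is second countable, so preimages of balls suffice, and `‖k(·, z) - x‖² = k(z, z) - 2 x(z) +
‖x‖²` is measurable in `z`. -/
lemma measurable_kerSec [MeasurableSpace Z] [TopologicalSpace.SeparableSpace H]
    [MeasurableSpace H] [BorelSpace H] (hk : Measurable fun x : Z × Z => ker H x.1 x.2) :
    Measurable fun z : Z => kerSec H z := by
  have : SecondCountableTopology H := UniformSpace.secondCountable_of_separable H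
  have hbasis : TopologicalSpace.IsTopologicalBasis
      {s : Set H | ∃ (x : H) (r : ℝ), s = Metric.ball x r} := by
    refine TopologicalSpace.isTopologicalBasis_of_isOpen_of_nhds ?_ fun x u hx hu => ?_
    · rintro s ⟨x, r, rfl⟩
      exact Metric.isOpen_ball
    · obtain ⟨r, hr, hru⟩ := Metric.isOpen_iff.1 hu x hx
      exact ⟨_, ⟨x, r, rfl⟩, Metric.mem_ball_self hr, hru⟩
  rw [BorelSpace.measurable_eq (α := H), hbasis.borel_eq_generateFrom]
  refine measurable_generateFrom ?_
  rintro s ⟨x, r, rfl⟩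
  have h1 : ∀ z : Z, dist (kerSec H z) x = Real.sqrt (ker H z z - 2 * x z + ‖x‖ ^ 2) := fun z => by
    rw [dist_eq_norm, ← norm_kerSec_sq, ← inner_kerSec x z, ← norm_sub_sq_real,
      Real.sqrt_sq (norm_nonneg _)]
  have h2 : Measurable fun z : Z => dist (kerSec H z) x := by
    simp only [h1]
    have hpair : Measurable fun z : Z => (z, z) := by fun_prop
    have hcomp := Measurable.comp (g := fun x : Z × Z => ker H x.1 x.2) hk hpair
    have hdiag : Measurable fun z : Z => ker H z z := hcomp
    have hx : Measurable fun z : Z => x z := measurable_coe hk x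
    fun_prop
  exact measurableSet_lt h2 measurable_const

lemma adjoint_sampleOp {n : ℕ} (z : Fin n → Z) (v : EuclideanSpace ℝ (Fin n)) :
    (sampleOp z).adjoint v = ∑ i, v i • kerSec H (z i) := by
  refine ext_inner_right ℝ fun u => ?_
  rw [ContinuousLinearMap.adjoint_inner_left, sum_inner, PiLp.inner_apply]
  refine Finset.sum_congr rfl fun i _ => ?_
  rw [real_inner_smul_left, inner_kerSec, sampleOp_apply]
  simp [mul_comm]

lemma norm_sampleOp_sq {n : ℕ} (z : Fin n → Z) (u : H) :
    ‖sampleOp z u‖ ^ 2 = ∑ i, (u (z i)) ^ 2 := by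
  rw [EuclideanSpace.real_norm_sq_eq]
  simp only [sampleOp_apply]

end KernelSections

/-! ### Population identities -/

section PopulationIdentities

variable {Z : Type*} [MeasurableSpace Z] {H : Type*} [NormedAddCommGroup H] [InnerProductSpace ℝ H]
  [CompleteSpace H] [RKHS ℝ H Z ℝ]
  (hk : Measurable fun x : Z × Z => ker H x.1 x.2)
  (hb : BddAbove (Set.range fun z : Z => ker H z z))
  (P Q : Measure Z) [IsProbabilityMeasure P]
  (hg : MemLp (densityRatio P Q) 2 P)
  {p : Z → ℝ} (hp : Measurable p) (hpb : BddAbove (Set.range fun z => |p z|))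

lemma coeFn_embL2 (h : H) : embL2 hk hb P h =ᵐ[P] h :=
  (memLp_coe hk hb P h).coeFn_toLp

lemma norm_embL2_le (h : H) : ‖embL2 hk hb P h‖ ≤ Real.sqrt (kappa H) * ‖h‖ :=
  (embL2 hk hb P).le_of_opNorm_le (LinearMap.mkContinuous_norm_le _ (Real.sqrt_nonneg _) _) h

variable {P Q} in
lemma inner_residual_sub_embL2 [IsProbabilityMeasure Q] (hQP : Q ≪ P) (h : H) (f : Lp ℝ 2 P) :
    inner ℝ (residual P Q hg hp hpb - embL2 hk hb P h) f =
      (∫ z, f z ∂Q) - ∫ z, f z * (p z + h z) ∂P := by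
  have hph : MemLp (fun z => p z + h z) 2 P :=
    (memLp_of_bdd P hp hpb).add (memLp_coe hk hb P h)
  have h1 : Integrable (fun z => densityRatio P Q z * f z) P := hg.integrable_mul (Lp.memLp f)
  have h2 : Integrable (fun z => f z * (p z + h z)) P := (Lp.memLp f).integrable_mul hph
  have h3 : ∫ z, f z ∂Q = ∫ z, densityRatio P Q z * f z ∂P :=
    (integral_toReal_rnDeriv_mul hQP).symm
  rw [h3, ← integral_sub h1 h2, L2.inner_def]
  refine integral_congr_ae ?_
  have hr : residual P Q hg hp hpb =ᵐ[P] densityRatio P Q - p := MemLp.coeFn_toLp _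
  filter_upwards [Lp.coeFn_sub (residual P Q hg hp hpb) (embL2 hk hb P h), hr,
    coeFn_embL2 hk hb P h] with z hz1 hz2 hz3
  simp only [hz1, Pi.sub_apply, hz2, hz3, RCLike.inner_apply, conj_trivial]
  ring

variable {P Q} in
/-- The worst-case error is an `L²(P)` distance. -/
lemma worstCaseError_eq_norm [IsProbabilityMeasure Q] (hQP : Q ≪ P) (h : H) :
    worstCaseError P Q p h = ‖residual P Q hg hp hpb - embL2 hk hb P h‖ := by
  set w := residual P Q hg hp hpb - embL2 hk hb P h with hw
  have hterm : ∀ f : Metric.closedBall (0 : Lp ℝ 2 P) 1,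
      |(∫ z, (f : Lp ℝ 2 P) z ∂Q) - ∫ z, (f : Lp ℝ 2 P) z * (p z + h z) ∂P| =
        |inner ℝ w (f : Lp ℝ 2 P)| := fun f => by
    rw [hw, inner_residual_sub_embL2 hk hb hg hp hpb hQP h]
  have hle : ∀ f : Metric.closedBall (0 : Lp ℝ 2 P) 1, |inner ℝ w (f : Lp ℝ 2 P)| ≤ ‖w‖ :=
    fun f => (abs_real_inner_le_norm _ _).trans
      (mul_le_of_le_one_right (norm_nonneg _) (mem_closedBall_zero_iff.1 f.2))
  rw [worstCaseError]
  simp only [hterm]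
  have : Nonempty (Metric.closedBall (0 : Lp ℝ 2 P) 1) := ⟨⟨0, by simp⟩⟩
  refine le_antisymm (ciSup_le hle) ?_
  -- The normalized `w` attains the supremum; for `w = 0` it is the zero vector, which still works.
  have hmem : ‖w‖⁻¹ • w ∈ Metric.closedBall (0 : Lp ℝ 2 P) 1 := by
    rw [mem_closedBall_zero_iff, norm_smul, norm_inv, norm_norm]
    exact inv_mul_le_one
  have hval : |inner ℝ w (‖w‖⁻¹ • w)| = ‖w‖ := by
    rw [real_inner_smul_right, real_inner_self_eq_norm_sq]
    by_cases h0 : ‖w‖ = 0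
    · simp [h0]
    · rw [sq, ← mul_assoc, inv_mul_cancel₀ h0, one_mul, abs_norm]
  refine hval.symm.trans_le (le_ciSup (f := fun f : Metric.closedBall (0 : Lp ℝ 2 P) 1 =>
    |inner ℝ w (f : Lp ℝ 2 P)|) ⟨‖w‖, ?_⟩ ⟨_, hmem⟩)
  rintro _ ⟨f, rfl⟩
  exact hle f

/-- This stationarity identity supplies the expectation of the empirical residual in the
concentration step. -/
lemma popEstimator_spec {lam : ℝ} (hlam : 0 < lam) :
    (embL2 hk hb P).adjoint (residual P Q hg hp hpb -
      embL2 hk hb P (popEstimator (H := H) hk hb P Q hg hp hpb lam)) =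
      lam • popEstimator (H := H) hk hb P Q hg hp hpb lam := by
  have h := regInv_spec (ContinuousLinearMap.isPositive_adjoint_comp_self (embL2 hk hb P)) hlam
    ((embL2 hk hb P).adjoint (residual P Q hg hp hpb))
  rw [map_sub, sub_eq_iff_eq_add, add_comm]
  exact h.symm

/-- Under the source condition, the population estimator shrinks the source element, with
approximation error of order `√λ`. -/
lemma popEstimator_source {lam : ℝ} (hlam : 0 < lam) {h₀ : H}
    (h₀r : residual P Q hg hp hpb = embL2 hk hb P h₀) :
    ‖popEstimator (H := H) hk hb P Q hg hp hpb lam‖ ≤ ‖h₀‖ ∧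
      ‖residual P Q hg hp hpb - embL2 hk hb P (popEstimator (H := H) hk hb P Q hg hp hpb lam)‖ ≤
        ‖h₀‖ * Real.sqrt lam / 2 := by
  have h := popEstimator_spec (H := H) hk hb P Q hg hp hpb hlam
  set x := popEstimator (H := H) hk hb P Q hg hp hpb lam
  rw [h₀r, ← map_sub] at h ⊢
  set d := h₀ - x with hd
  constructor
  -- Since `λ x = J* J d`, the vectors `x` and `d` form a nonobtuse angle, so `‖x‖ ≤ ‖x + d‖ =
  -- ‖h₀‖`.
  · have h1 : lam * inner ℝ x d = ‖embL2 hk hb P d‖ ^ 2 := by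
      rw [← real_inner_smul_left, ← h, ContinuousLinearMap.adjoint_inner_left,
        real_inner_self_eq_norm_sq]
    have h2 : 0 ≤ inner ℝ x d := by
      by_contra! h3
      nlinarith [sq_nonneg ‖embL2 hk hb P d‖, mul_neg_of_pos_of_neg hlam h3]
    have h3 : ‖h₀‖ ^ 2 = ‖x‖ ^ 2 + 2 * inner ℝ x d + ‖d‖ ^ 2 := by
      rw [← norm_add_sq_real, hd, add_sub_cancel]
    refine (sq_le_sq₀ (norm_nonneg _) (norm_nonneg _)).1 ?_
    nlinarith [sq_nonneg ‖d‖]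
  · have h1 : (embL2 hk hb P).adjoint (embL2 hk hb P d) + lam • d = lam • h₀ := by
      rw [h, hd, smul_sub, add_sub_cancel]
    refine (norm_map_le_of_regularized _ hlam h1).trans_eq ?_
    rw [norm_smul, Real.norm_of_nonneg hlam.le]
    have := Real.sqrt_pos.2 hlam
    field_simp
    rw [Real.sq_sqrt hlam.le, mul_comm]

end PopulationIdentities

/-! ### Sampling error -/

section Sampling

variable {Z : Type*} [MeasurableSpace Z] {H : Type*} [NormedAddCommGroup H] [InnerProductSpace ℝ H]
  [CompleteSpace H] [RKHS ℝ H Z ℝ] [MeasurableSpace H] [BorelSpace H]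
  [TopologicalSpace.SeparableSpace H]

/-- Tested against `u`, the reproducing property turns both Bochner integrals into integrals of `u`.
-/
lemma mean_embedding_sub (hk : Measurable fun x : Z × Z => ker H x.1 x.2)
    (hb : BddAbove (Set.range fun z : Z => ker H z z))
    {P Q : Measure Z} [IsProbabilityMeasure P] [IsProbabilityMeasure Q] (hQP : Q ≪ P)
    (hg : MemLp (densityRatio P Q) 2 P)
    {p : Z → ℝ} (hp : Measurable p) (hpb : BddAbove (Set.range fun z => |p z|)) (h : H) :
    (∫ z, kerSec H z ∂Q) - ∫ z, (p z + h z) • kerSec H z ∂P =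
      (embL2 hk hb P).adjoint (residual P Q hg hp hpb - embL2 hk hb P h) := by
  have : SecondCountableTopology H := UniformSpace.secondCountable_of_separable H
  have hkm : Measurable fun z : Z => kerSec H z := measurable_kerSec hk
  have hQi : Integrable (fun z => kerSec H z) Q :=
    integrable_of_measurable_of_bounded hkm (norm_kerSec_le hb)
  have hPi : Integrable (fun z => (p z + h z) • kerSec H z) P :=
    integrable_of_measurable_of_bounded ((hp.add (measurable_coe hk h)).smul hkm)
      (norm_weighted_kerSec_le hb hpb h)
  refine ext_inner_left ℝ fun u => ?_
  rw [ContinuousLinearMap.adjoint_inner_right,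
    real_inner_comm (residual P Q hg hp hpb - embL2 hk hb P h),
    inner_residual_sub_embL2 hk hb hg hp hpb hQP h, inner_sub_right, ← integral_inner hQi,
    ← integral_inner hPi]
  have hu := coeFn_embL2 hk hb P u
  congr 1
  · refine integral_congr_ae ?_
    filter_upwards [hQP.ae_le hu] with z hz
    rw [hz, real_inner_comm, inner_kerSec]
  · refine integral_congr_ae ?_
    filter_upwards [hu] with z hz
    rw [hz, real_inner_smul_right, real_inner_comm, inner_kerSec, mul_comm]

/-- Concentration of the empirical mean embeddings. -/
lemma exists_sampling_event (hk : Measurable fun x : Z × Z => ker H x.1 x.2)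
    (hb : BddAbove (Set.range fun z : Z => ker H z z))
    {P Q : Measure Z} [IsProbabilityMeasure P] [IsProbabilityMeasure Q] (hQP : Q ≪ P)
    (hg : MemLp (densityRatio P Q) 2 P)
    {p : Z → ℝ} (hp : Measurable p) (hpb : BddAbove (Set.range fun z => |p z|)) (h : H)
    {Ω : Type*} [MeasurableSpace Ω] {μ : Measure Ω} [IsProbabilityMeasure μ]
    {n : ℕ} {zP zQ : Fin n → Ω → Z}
    (hzP : ∀ i, Measurable (zP i)) (hzQ : ∀ i, Measurable (zQ i))
    (hlawP : ∀ i, μ.map (zP i) = P) (hlawQ : ∀ i, μ.map (zQ i) = Q)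
    (hindep : iIndepFun (Sum.elim zP zQ) μ) {η : ℝ} (hη : η ∈ Set.Ioo (0 : ℝ) 1) :
    ∃ A : Set Ω, MeasurableSet A ∧ 1 - η ≤ μ.real A ∧ ∀ ω ∈ A,
      ‖(∑ i, kerSec H (zQ i ω)) - (∑ i, (p (zP i ω) + h (zP i ω)) • kerSec H (zP i ω)) -
        (n : ℝ) • (embL2 hk hb P).adjoint (residual P Q hg hp hpb - embL2 hk hb P h)‖ ≤
        Real.sqrt n * CFS (kappa H) (⨆ z, |p z|) η ‖h‖ := by
  have : SecondCountableTopology H := UniformSpace.secondCountable_of_separable H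
  have hkm : Measurable fun z : Z => kerSec H z := measurable_kerSec hk
  have hwm : Measurable fun z => (p z + h z) • kerSec H z :=
    (hp.add (measurable_coe hk h)).smul hkm
  set κ := kappa H with hκ
  set π := ⨆ z, |p z| with hπ
  have hκ0 : 0 ≤ κ := kappa_nonneg
  have hπ0 : 0 ≤ π := Real.iSup_nonneg fun z => abs_nonneg _
  set mQ := ∫ z, kerSec H z ∂Q with hmQ
  set mP := ∫ z, (p z + h z) • kerSec H z ∂P with hmP
  have hmean : mQ - mP = (embL2 hk hb P).adjoint (residual P Q hg hp hpb - embL2 hk hb P h) :=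
    mean_embedding_sub hk hb hQP hg hp hpb h
  have hbP := norm_weighted_kerSec_le hb hpb h
  have hbQ := norm_kerSec_le hb
  set b := (π + ‖h‖ * Real.sqrt κ) * Real.sqrt κ with hbdef
  have hmQb : ‖mQ‖ ≤ Real.sqrt κ := by
    simpa using norm_integral_le_of_norm_le_const (μ := Q) (Filter.Eventually.of_forall hbQ)
  have hmPb : ‖mP‖ ≤ b := by
    simpa using norm_integral_le_of_norm_le_const (μ := P) (Filter.Eventually.of_forall hbP)
  -- The `P`-terms carry the opposite sign, so that the `2n` summands add up to the deviation
  -- itself. Centering a vector bounded by `b` or `√κ` doubles the bound, whence `c`.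
  let g : Fin n ⊕ Fin n → Z → H :=
    Sum.elim (fun _ z => mP - (p z + h z) • kerSec H z) (fun _ z => kerSec H z - mQ)
  let c : Fin n ⊕ Fin n → ℝ := Sum.elim (fun _ => 2 * b) (fun _ => 2 * Real.sqrt κ)
  have hgm : ∀ i, Measurable (g i) := by
    rintro (i | i)
    · exact measurable_const.sub hwm
    · exact hkm.sub_const _
  have hzm : ∀ i, Measurable (Sum.elim zP zQ i) := by
    rintro (i | i)
    · exact hzP i
    · exact hzQ i
  have hgc : ∀ i z, ‖g i z‖ ≤ c i := by
    rintro (i | i) z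
    · exact (norm_sub_le _ _).trans ((add_le_add hmPb (hbP z)).trans_eq (two_mul b).symm)
    · exact (norm_sub_le _ _).trans ((add_le_add (hbQ z) hmQb).trans_eq (two_mul _).symm)
  have hg0 : ∀ i, ∫ ω, g i (Sum.elim zP zQ i ω) ∂μ = 0 := by
    intro i
    rw [← integral_map (hzm i).aemeasurable (hgm i).aestronglyMeasurable]
    rcases i with i | i
    · change ∫ z, (mP - (p z + h z) • kerSec H z) ∂(μ.map (zP i)) = 0
      rw [hlawP, integral_sub (integrable_const _) (integrable_of_measurable_of_bounded hwm hbP)]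
      simp [hmP]
    · change ∫ z, (kerSec H z - mQ) ∂(μ.map (zQ i)) = 0
      rw [hlawQ, integral_sub (integrable_of_measurable_of_bounded hkm hbQ) (integrable_const _)]
      simp [hmQ]
  have hX : ∀ i, Measurable fun ω => g i (Sum.elim zP zQ i ω) := fun i => (hgm i).comp (hzm i)
  have hconc := one_sub_le_measureReal_norm_sum_le hX (hindep.comp g hgm) (fun i ω => hgc i _) hg0
    hη.1 hη.2
  refine ⟨_, measurableSet_le (Finset.measurable_sum _ fun i _ => hX i).norm measurable_const,
    hconc, fun ω hω => ?_⟩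
  change ‖∑ i, g i (Sum.elim zP zQ i ω)‖ ≤ Real.sqrt (2 * Real.log (2 / η) * ∑ i, c i ^ 2) at hω
  have hsum : ∑ i, g i (Sum.elim zP zQ i ω) = (∑ i, kerSec H (zQ i ω)) -
      (∑ i, (p (zP i ω) + h (zP i ω)) • kerSec H (zP i ω)) - (n : ℝ) • (mQ - mP) := by
    rw [Fintype.sum_sum_type]
    simp only [g, Sum.elim_inl, Sum.elim_inr, Finset.sum_sub_distrib, Finset.sum_const,
      Finset.card_univ, Fintype.card_fin, ← Nat.cast_smul_eq_nsmul ℝ, smul_sub]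
    abel
  rw [← hmean, ← hsum]
  refine hω.trans (Real.sqrt_le_left (by unfold CFS; positivity) |>.2 ?_)
  have hl0 : 0 ≤ Real.log (2 / η) :=
    Real.log_nonneg (by rw [le_div_iff₀ hη.1]; linarith [hη.2])
  have hcs : ∑ i, c i ^ 2 = n * (4 * (b ^ 2 + κ)) := by
    rw [Fintype.sum_sum_type]
    simp only [c, Sum.elim_inl, Sum.elim_inr, Finset.sum_const, Finset.card_univ,
      Fintype.card_fin, nsmul_eq_mul, mul_pow, Real.sq_sqrt hκ0]
    ring
  set s := ‖h‖ * Real.sqrt κ with hs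
  have hs0 : 0 ≤ s := by positivity
  -- After factoring out `κ` this is `(π + s)² + 1 ≤ (1 + π + s)²`.
  have hb2 : b ^ 2 + κ ≤ κ * (1 + π + s) ^ 2 := by
    rw [hbdef, mul_pow, Real.sq_sqrt hκ0]
    nlinarith [mul_nonneg hκ0 (add_nonneg hπ0 hs0)]
  have hCFS : (Real.sqrt n * CFS κ π η ‖h‖) ^ 2 =
      n * (4 * (2 * Real.log (2 / η) * κ) * (1 + π + s) ^ 2) := by
    rw [CFS, mul_pow, Real.sq_sqrt (Nat.cast_nonneg n), mul_pow, mul_pow,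
      Real.sq_sqrt (by positivity)]
    ring
  rw [hcs, hCFS]
  calc 2 * Real.log (2 / η) * (n * (4 * (b ^ 2 + κ)))
      ≤ 2 * Real.log (2 / η) * (n * (4 * (κ * (1 + π + s) ^ 2))) := by gcongr
    _ = _ := by ring

end Sampling

/-! ### Deterministic error of the low-rank estimator -/

section LowRank

variable {Z : Type*} {H : Type*} [NormedAddCommGroup H] [InnerProductSpace ℝ H] [CompleteSpace H]
  [RKHS ℝ H Z ℝ]

lemma lowRankEstimator_spec {n : ℕ} (hn : 1 ≤ n) (zP zQ : Fin n → Z) (p : Z → ℝ) {lam : ℝ}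
    (hlam : 0 < lam) (piv : List (Fin n ⊕ Fin n)) :
    (pivotSpace H (Sum.elim zP zQ) piv).starProjection ((sampleOp zP).adjoint (sampleOp zP
      ((pivotSpace H (Sum.elim zP zQ) piv).starProjection
        (lowRankEstimator H zP zQ p lam piv)))) +
      ((n : ℝ) * lam) • lowRankEstimator H zP zQ p lam piv =
    (pivotSpace H (Sum.elim zP zQ) piv).starProjection
      ((∑ i, kerSec H (zQ i)) - ∑ i, p (zP i) • kerSec H (zP i)) := by
  have hc : 0 < (n : ℝ) * lam := mul_pos (by exact_mod_cast hn) hlam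
  have h := regInv_spec ((ContinuousLinearMap.isPositive_adjoint_comp_self
    (sampleOp (H := H) zP)).conj_starProjection (pivotSpace H (Sum.elim zP zQ) piv)) hc
    (pivotProj H (Sum.elim zP zQ) piv
      ((sampleOp zQ).adjoint (WithLp.toLp 2 fun _ => (1 : ℝ)) -
        (sampleOp zP).adjoint (WithLp.toLp 2 fun i => p (zP i))))
  refine h.trans ?_
  rw [adjoint_sampleOp, adjoint_sampleOp, pivotProj]
  simp only [one_smul]

lemma sum_le_sqrt_mul_sqrt_card {n : ℕ} {a : Fin n → ℝ} {ε : ℝ} (h : ∑ i, a i ^ 2 ≤ ε) :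
    ∑ i, a i ≤ Real.sqrt ε * Real.sqrt n := by
  rw [← Real.sqrt_mul ((Finset.sum_nonneg fun i _ => sq_nonneg (a i)).trans h)]
  refine Real.le_sqrt_of_sq_le (sq_sum_le_card_mul_sum_sq.trans ?_)
  rw [Finset.card_univ, Fintype.card_fin, mul_comm]
  gcongr

/-- Compares both functions with the full-rank solution `x`. The hypothesis `hR` bounds the residual
of `h` in the empirical equation; the stopping rule supplies `δ = √ε` and the residual of the data
for `norm_projected_sub_le`. -/
lemma norm_sub_lowRankEstimator_le (hb : BddAbove (Set.range fun z : Z => ker H z z))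
    {p : Z → ℝ} (hpb : BddAbove (Set.range fun z => |p z|)) {n : ℕ} (hn : 1 ≤ n)
    (zP zQ : Fin n → Z) {lam : ℝ} (hlam : 0 < lam) {ε R : ℝ} {piv : List (Fin n ⊕ Fin n)}
    (hpiv : IsCholOutput (kernelMatrix H (Sum.elim zP zQ)) ε piv) (h : H)
    (hR : ‖(∑ i, kerSec H (zQ i)) - (∑ i, (p (zP i) + h (zP i)) • kerSec H (zP i)) -
      (n : ℝ) • lam • h‖ ≤ Real.sqrt n * R) :
    ‖h - lowRankEstimator H zP zQ p lam piv‖ ≤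
      (R + CAE (kappa H) (⨆ z, |p z|) ε lam) * lam⁻¹ * (Real.sqrt n)⁻¹ := by
  have hn0 : (0 : ℝ) < n := by exact_mod_cast hn
  have hc : 0 < (n : ℝ) * lam := mul_pos hn0 hlam
  set κ := kappa H with hκ
  set π := ⨆ z, |p z| with hπ
  have hpπ : ∀ z, |p z| ≤ π := fun z => le_ciSup hpb z
  have hπ0 : 0 ≤ π := Real.iSup_nonneg fun z => abs_nonneg _
  set S := sampleOp (H := H) zP with hS
  set b := (∑ i, kerSec H (zQ i)) - ∑ i, p (zP i) • kerSec H (zP i) with hbdef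
  set V := pivotSpace H (Sum.elim zP zQ) piv with hV
  set y := lowRankEstimator H zP zQ p lam piv with hy
  set x := regInv (S.adjoint ∘L S) (n * lam) b with hx
  have hxs : S.adjoint (S x) + ((n : ℝ) * lam) • x = b :=
    regInv_spec (ContinuousLinearMap.isPositive_adjoint_comp_self S) hc b
  have hys := lowRankEstimator_spec (H := H) hn zP zQ p hlam piv
  have hres := sum_norm_pivotResidual_sq_le H hpiv
  rw [Fintype.sum_sum_type] at hres
  have hP2 : ∑ i, ‖pivotResidual H (Sum.elim zP zQ) piv (Sum.inl i)‖ ^ 2 ≤ ε := by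
    have : 0 ≤ ∑ i, ‖pivotResidual H (Sum.elim zP zQ) piv (Sum.inr i)‖ ^ 2 :=
      Finset.sum_nonneg fun i _ => sq_nonneg _
    linarith
  have hQ2 : ∑ i, ‖pivotResidual H (Sum.elim zP zQ) piv (Sum.inr i)‖ ^ 2 ≤ ε := by
    have : 0 ≤ ∑ i, ‖pivotResidual H (Sum.elim zP zQ) piv (Sum.inl i)‖ ^ 2 :=
      Finset.sum_nonneg fun i _ => sq_nonneg _
    linarith
  -- A Hilbert–Schmidt bound: the coordinates of `S (v - P_Π v)` are inner products of `v` with the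
  -- residual sections.
  have hSop : ∀ v, ‖S (v - V.starProjection v)‖ ≤ Real.sqrt ε * ‖v‖ := fun v => by
    have hε0 : 0 ≤ ε := (Finset.sum_nonneg fun i _ => sq_nonneg _).trans hP2
    refine (sq_le_sq₀ (norm_nonneg _) (by positivity)).1 ?_
    rw [hS, norm_sampleOp_sq, mul_pow, Real.sq_sqrt hε0]
    calc ∑ i, ((v - V.starProjection v : H) (zP i)) ^ 2
        ≤ ∑ i, ‖pivotResidual H (Sum.elim zP zQ) piv (Sum.inl i)‖ ^ 2 * ‖v‖ ^ 2 := by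
          refine Finset.sum_le_sum fun i _ => ?_
          have h1 : (v - V.starProjection v : H) (zP i) =
              inner ℝ (pivotResidual H (Sum.elim zP zQ) piv (Sum.inl i)) v := by
            rw [← inner_kerSec, inner_sub_right, ← Submodule.inner_starProjection_left_eq_right,
              ← inner_sub_left]
            rfl
          rw [h1, ← mul_pow, ← sq_abs]
          gcongr
          exact abs_real_inner_le_norm _ _
      _ ≤ ε * ‖v‖ ^ 2 := by rw [← Finset.sum_mul]; gcongr
  have hbn : ‖b‖ ≤ n * Real.sqrt κ * (1 + π) := by
    have h1 : ‖∑ i, kerSec H (zQ i)‖ ≤ n * Real.sqrt κ := by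
      refine (norm_sum_le_of_le _ fun i _ => norm_kerSec_le hb (zQ i)).trans_eq ?_
      simp [hκ]
    have h2 : ‖∑ i, p (zP i) • kerSec H (zP i)‖ ≤ n * (π * Real.sqrt κ) := by
      refine (norm_sum_le_of_le (f := fun i => p (zP i) • kerSec H (zP i)) _
        fun i _ => (?_ : _ ≤ π * Real.sqrt κ)).trans_eq ?_
      · rw [norm_smul]
        exact mul_le_mul (hpπ _) (norm_kerSec_le hb _) (norm_nonneg _) hπ0
      · simp
    exact (norm_sub_le _ _).trans ((add_le_add h1 h2).trans_eq (by ring))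
  have hb1 : ‖b - V.starProjection b‖ ≤ Real.sqrt ε * Real.sqrt n * (1 + π) := by
    have h1 : b - V.starProjection b =
        (∑ i, pivotResidual H (Sum.elim zP zQ) piv (Sum.inr i)) -
          ∑ i, p (zP i) • pivotResidual H (Sum.elim zP zQ) piv (Sum.inl i) := by
      simp only [hbdef, pivotResidual, Sum.elim_inl, Sum.elim_inr, map_sub, map_sum, map_smul,
        smul_sub, Finset.sum_sub_distrib]
      abel
    have h2 : ‖∑ i, pivotResidual H (Sum.elim zP zQ) piv (Sum.inr i)‖ ≤
        Real.sqrt ε * Real.sqrt n := (norm_sum_le _ _).trans (sum_le_sqrt_mul_sqrt_card hQ2)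
    have h3 : ‖∑ i, p (zP i) • pivotResidual H (Sum.elim zP zQ) piv (Sum.inl i)‖ ≤
        π * (Real.sqrt ε * Real.sqrt n) := by
      refine (norm_sum_le_of_le (f := fun i => p (zP i) • pivotResidual H (Sum.elim zP zQ) piv
        (Sum.inl i)) _ fun i _ => ?_).trans
        ((Finset.mul_sum _ _ _).symm.trans_le (mul_le_mul_of_nonneg_left
          (sum_le_sqrt_mul_sqrt_card hP2) hπ0))
      rw [norm_smul]
      exact mul_le_mul_of_nonneg_right (hpπ _) (norm_nonneg _)
    rw [h1]
    exact (norm_sub_le _ _).trans ((add_le_add h2 h3).trans_eq (by ring))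
  have hxy := norm_projected_sub_le S V hc (Real.sqrt_nonneg ε) hxs hys hSop hbn hb1
  have hhx : ‖x - h‖ ≤ Real.sqrt n * R / (n * lam) := by
    have h1 : S.adjoint (S (x - h)) + ((n : ℝ) * lam) • (x - h) =
        (∑ i, kerSec H (zQ i)) - (∑ i, (p (zP i) + h (zP i)) • kerSec H (zP i)) -
          (n : ℝ) • lam • h := by
      have h2 : S.adjoint (S h) = ∑ i, h (zP i) • kerSec H (zP i) := by
        rw [hS, adjoint_sampleOp]
        simp only [sampleOp_apply]
      have h3 : S.adjoint (S (x - h)) + ((n : ℝ) * lam) • (x - h) =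
          b - S.adjoint (S h) - (n : ℝ) • lam • h := by
        rw [← hxs, map_sub, map_sub, smul_sub, smul_smul]
        abel
      rw [h3, h2, hbdef]
      simp only [add_smul, Finset.sum_add_distrib]
      abel
    exact (norm_le_of_regularized S hc h1).trans (by gcongr)
  rw [norm_sub_rev] at hhx
  have hsn := Real.sqrt_pos.2 hn0
  have hsl := Real.sqrt_pos.2 hlam
  calc ‖h - y‖ ≤ ‖h - x‖ + ‖x - y‖ := norm_sub_le_norm_sub_add_norm_sub _ _ _
    _ ≤ _ := add_le_add hhx hxy
    _ = _ := by
      rw [CAE, Real.sqrt_mul hn0.le]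
      have hnn : (n : ℝ) = Real.sqrt n * Real.sqrt n := (Real.mul_self_sqrt hn0.le).symm
      set t := Real.sqrt (n : ℝ)
      rw [hnn]
      field_simp
      ring

end LowRank

lemma CFS_mono {κ π η s s' : ℝ} (h : s ≤ s') : CFS κ π η s ≤ CFS κ π η s' := by
  unfold CFS
  gcongr

end KDM

theorem theorem2
    {Z : Type*} [MeasurableSpace Z] [MeasurableSpace.CountablyGenerated Z]
    (P Q : Measure Z) [IsProbabilityMeasure P] [IsProbabilityMeasure Q] (hQP : Q ≪ P)
    (hg : MemLp (KDM.densityRatio P Q) 2 P)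
    {H : Type*} [NormedAddCommGroup H] [InnerProductSpace ℝ H] [CompleteSpace H]
    [TopologicalSpace.SeparableSpace H] [RKHS ℝ H Z ℝ]
    (hk : Measurable fun x : Z × Z => KDM.ker H x.1 x.2)
    (hb : BddAbove (Set.range fun z : Z => KDM.ker H z z))
    (p : Z → ℝ) (hp : Measurable p) (hpb : BddAbove (Set.range fun z => |p z|))
    {Ω : Type*} [MeasurableSpace Ω] (μ : Measure Ω) [IsProbabilityMeasure μ]
    (n : ℕ) (hn : 1 ≤ n) (zP zQ : Fin n → Ω → Z)
    (hzP : ∀ i, Measurable (zP i)) (hzQ : ∀ i, Measurable (zQ i))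
    (hlawP : ∀ i, μ.map (zP i) = P) (hlawQ : ∀ i, μ.map (zQ i) = Q)
    (hindep : iIndepFun (Sum.elim zP zQ) μ)
    (lam : ℝ) (hlam : 0 < lam) (ε : ℝ) (hε : 0 ≤ ε) (η : ℝ) (hη : η ∈ Set.Ioo (0 : ℝ) 1) :
    ∃ A : Set Ω, MeasurableSet A ∧ 1 - η ≤ μ.real A ∧
      ∀ ω ∈ A, ∀ piv : List (Fin n ⊕ Fin n),
        KDM.IsCholOutput
          (KDM.kernelMatrix H (Sum.elim (fun i => zP i ω) (fun i => zQ i ω))) ε piv →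
        ‖KDM.popEstimator (H := H) hk hb P Q hg hp hpb lam -
            KDM.lowRankEstimator H (fun i => zP i ω) (fun i => zQ i ω) p lam piv‖
          ≤ (KDM.CFS (KDM.kappa H) (⨆ z, |p z|) η
                ‖KDM.popEstimator (H := H) hk hb P Q hg hp hpb lam‖
              + KDM.CAE (KDM.kappa H) (⨆ z, |p z|) ε lam) * lam⁻¹ * (Real.sqrt n)⁻¹ ∧
        KDM.worstCaseError P Q p
            (KDM.lowRankEstimator H (fun i => zP i ω) (fun i => zQ i ω) p lam piv)
          ≤ KDM.worstCaseError P Q p (KDM.popEstimator (H := H) hk hb P Q hg hp hpb lam)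
            + Real.sqrt (KDM.kappa H) *
              (KDM.CFS (KDM.kappa H) (⨆ z, |p z|) η
                  ‖KDM.popEstimator (H := H) hk hb P Q hg hp hpb lam‖
                + KDM.CAE (KDM.kappa H) (⨆ z, |p z|) ε lam) * lam⁻¹ * (Real.sqrt n)⁻¹ ∧
        ∀ h₀ : H, KDM.residual P Q hg hp hpb = KDM.embL2 hk hb P h₀ →
          KDM.worstCaseError P Q p
              (KDM.lowRankEstimator H (fun i => zP i ω) (fun i => zQ i ω) p lam piv)
            ≤ (Real.sqrt 2)⁻¹ * ‖h₀‖ * Real.sqrt lam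
              + Real.sqrt (KDM.kappa H) *
                (KDM.CFS (KDM.kappa H) (⨆ z, |p z|) η ‖h₀‖
                  + KDM.CAE (KDM.kappa H) (⨆ z, |p z|) ε lam) * lam⁻¹ * (Real.sqrt n)⁻¹ := by
  borelize H
  obtain ⟨A, hA, hAη, hAbound⟩ := KDM.exists_sampling_event hk hb hQP hg hp hpb
    (KDM.popEstimator (H := H) hk hb P Q hg hp hpb lam) hzP hzQ hlawP hlawQ hindep hη
  rw [KDM.popEstimator_spec hk hb P Q hg hp hpb hlam] at hAbound
  refine ⟨A, hA, hAη, fun ω hω piv hpiv => ?_⟩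
  set x := KDM.popEstimator (H := H) hk hb P Q hg hp hpb lam with hx
  have h1 := KDM.norm_sub_lowRankEstimator_le hb hpb hn _ _ hlam hpiv x (hAbound ω hω)
  set y := KDM.lowRankEstimator H (fun i => zP i ω) (fun i => zQ i ω) p lam piv
  have h2 : KDM.worstCaseError P Q p y ≤ KDM.worstCaseError P Q p x +
      Real.sqrt (KDM.kappa H) * ‖x - y‖ := by
    rw [KDM.worstCaseError_eq_norm hk hb hg hp hpb hQP,
      KDM.worstCaseError_eq_norm hk hb hg hp hpb hQP]
    refine le_trans ?_ (add_le_add le_rfl (KDM.norm_embL2_le hk hb P (x - y)))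
    rw [map_sub]
    exact (norm_sub_le_norm_sub_add_norm_sub _ _ _)
  have hκ := Real.sqrt_nonneg (KDM.kappa (Z := Z) H)
  have h3 := mul_le_mul_of_nonneg_left h1 hκ
  simp only [← mul_assoc] at h3
  refine ⟨h1, h2.trans (add_le_add le_rfl h3), fun h₀ hh₀ => ?_⟩
  obtain ⟨h4, h5⟩ := KDM.popEstimator_source hk hb P Q hg hp hpb hlam hh₀
  rw [← hx] at h4 h5
  rw [← KDM.worstCaseError_eq_norm hk hb hg hp hpb hQP] at h5
  refine h2.trans (add_le_add (h5.trans ?_) (h3.trans ?_))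
  · have h6 : (2 : ℝ)⁻¹ ≤ (Real.sqrt 2)⁻¹ := by
      gcongr
      exact Real.sqrt_le_left (by norm_num) |>.2 (by norm_num)
    have h7 : 0 ≤ ‖h₀‖ * Real.sqrt lam := by positivity
    nlinarith [mul_le_mul_of_nonneg_right h6 h7]
  · have h6 := KDM.CFS_mono (κ := KDM.kappa (Z := Z) H) (π := ⨆ z, |p z|) (η := η) h4
    have h7 : 0 ≤ lam⁻¹ := by positivity
    gcongr
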